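/- Let $n \ge 0$ and let $\Delta_n=\{x\in\mathbb R^n : x_k\ge 0 \text{ for } 0\le k\le n\}$ be the $n$-simplex with vertices $0,e_1,\dots,e_n$, where $x_0 = 1-x_1-\dots-x_n$, so that $(x_0,\dots,x_n)$ are the barycentric coordinates of $x$. Let $\mu$ be the uniform measure on $\Delta_n$, normalized to total mass $1$. A positive $t$-cubature formula $F$ on $\Delta_n$ is a finite set of points $p_a\in\mathbb R^n$ with weights $w_a>0$ such that $\int P\,d\mu=\sum_a w_aP(p_a)$ for every real polynomial $P$ of degree at most $t$. It is interior if every $p_a$ lies in the interior of $\Delta_n$, and boundary if every $p_a$ lies in $\Delta_n$ and at least one lies on $\partial\Delta_n$. Any sequence of positive interior or positive boundary $t$-cubature formulas on $\Delta_n$ has limiting point density $\Omega\bigl(t^n\prod_k x_k^{-1/2}\bigr)$ at every fixed point $x\in\Delta_n$, as $t\to\infty$. Precisely, there is a constant $c>0$, depending only on $n$, with the following property. Let $t_j\to\infty$ be natural numbers and, for each $j$, let $F_j$ be a positive $t_j$-cubature formula on $\Delta_n$ that is interior or boundary. Then for every $x\in\Delta_n$ and every sequence of radii $r_j>0$ with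 $r_j\to0$ and $t_jr_j\to\infty$, $$\liminf_{j\to\infty}\ \frac{\#\bigl(F_j\cap B(x,r_j)\bigr)}{t_j^{\,n}\;\mu\bigl(B(x,r_j)\bigr)}\ \ge\ c\,\prod_{k=0}^n x_k^{-1/2},$$ where $\#(F_j\cap B(x,r))$ is the number of points of $F_j$ in the open Euclidean ball $B(x,r)$ of radius $r$ around $x$. If $x\in\partial\Delta_n$, the right-hand side is $+\infty$, and the claim is that the left-hand side is $+\infty$ as well. -/

import Mathlib

open MeasureTheory Filter Topology
open scoped ENNReal NNReal

/-- A finite set of evaluation points in `ℝⁿ` together with real weights (only the values of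
`weight` on `points` matter). -/
structure WeightedPoints (n : ℕ) where
  points : Finset (EuclideanSpace ℝ (Fin n))
  weight : EuclideanSpace ℝ (Fin n) → ℝ

namespace WeightedPoints

variable {n : ℕ}

/-- `F` is a cubature formula of degree `t` for `μ`: it integrates exactly all real polynomials in
`n` variables of total degree at most `t`. -/
def IsCubature (F : WeightedPoints n) (μ : Measure (EuclideanSpace ℝ (Fin n))) (t : ℕ) : Prop :=
  ∀ P : MvPolynomial (Fin n) ℝ, P.totalDegree ≤ t →
    ∫ x, MvPolynomial.eval (fun i => x i) P ∂μ =
      ∑ p ∈ F.points, F.weight p * MvPolynomial.eval (fun i => p i) P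

/-- All weights are positive. -/
def IsPositive (F : WeightedPoints n) : Prop :=
  ∀ p ∈ F.points, 0 < F.weight p

/-- Every point lies in the interior of the support of `μ`. -/
def IsInterior (F : WeightedPoints n) (μ : Measure (EuclideanSpace ℝ (Fin n))) : Prop :=
  ∀ p ∈ F.points, p ∈ interior μ.support

/-- Every point lies in the support of `μ`, and some point lies on its boundary. -/
def IsBoundary (F : WeightedPoints n) (μ : Measure (EuclideanSpace ℝ (Fin n))) : Prop :=
  (∀ p ∈ F.points, p ∈ μ.support) ∧ ∃ p ∈ F.points, p ∈ frontier μ.support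

open Classical in
/-- The point density of `F` at `x` at scale `r`: the number of points of `F` in the Euclidean
ball of radius `r` around `x`, per unit of `μ`-measure. -/
noncomputable def pointDensity (F : WeightedPoints n)
    (μ : Measure (EuclideanSpace ℝ (Fin n))) (x : EuclideanSpace ℝ (Fin n)) (r : ℝ) : ℝ≥0∞ :=
  ((F.points.filter (fun p => p ∈ Metric.ball x r)).card : ℝ≥0∞) / μ (Metric.ball x r)

end WeightedPoints

/-- The barycentric coordinates `(x₀, x₁, …, xₙ)`, `x₀ = 1 - x₁ - ⋯ - xₙ`, of a point of `ℝⁿ`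
with respect to the simplex with vertices `0, e₁, …, eₙ`. -/
def barycentric {n : ℕ} (x : EuclideanSpace ℝ (Fin n)) : Fin (n + 1) → ℝ :=
  Fin.cons (1 - ∑ i, x i) (fun i => x i)

/-- The `n`-simplex `Δₙ` with vertices `0, e₁, …, eₙ`. -/
def solidSimplex (n : ℕ) : Set (EuclideanSpace ℝ (Fin n)) :=
  {x | ∀ k, 0 ≤ barycentric x k}

/-- Uniform measure on `Δₙ`: Lebesgue measure restricted to `Δₙ`, of total mass `1`. -/
noncomputable def simplexMeasure (n : ℕ) : Measure (EuclideanSpace ℝ (Fin n)) :=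
  (volume (solidSimplex n))⁻¹ • volume.restrict (solidSimplex n)

/-! The number of points in a ball is at least the total weight in the ball divided by the largest
single weight there. Both quantities are controlled by testing the formula on polynomials. Apart
from exactness, only positivity of the weights and containment of the points in the simplex enter.

Upper bound on one weight (`WeightedPoints.weight_le`). If `P ≥ 0` on the simplex and `P(p) ≥ 1`,
then the weight of `p` is at most `∫ P dμ`. Take `P` to be a product of one-variable kernels in `n`
of the barycentric coordinates. Substituting `y = s²` in one coordinate, a Jackson kernel of width
`1/m` around `s = √p_j` becomes a polynomial in `y` whose integral has order at most `(√p_j +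
1/m)/m` (`exists_endpoint_kernel`). The omitted coordinate is at least `1/(n+1)`, so its factor can
be restored at bounded cost. With `m` of order `t`, weights are `O(t^{-n} ∏ (√p_j + 1/t))`.

Lower bound on the mass of a ball (`WeightedPoints.le_sum_weight_ball`). A product of Jackson
kernels centred at `x`, times `1 - |y - x|²/r²`, is at most `1` in the ball and at most `0` on the
rest of the simplex. If the kernel width is a small multiple of `r`, the negative part costs at most
half of the integral, so the mass is at least of order `r^n`. The degree needed is of order `1/r`,
which is available once `t r` is large.

Dividing gives `exists_le_card_ball`, with each `x_j` blurred by terms of order `r` and `1/t`; these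
vanish in the limit. At the boundary the limiting product of square roots is `0`, which yields the
infinite density. -/

/-! ### The Jackson kernel -/

/-- The polynomial of degree `2k` in `s` whose value at `sin a` is `sin ((2k+1)a) / sin a`. -/
noncomputable def dirichletPoly (k : ℕ) : Polynomial ℝ :=
  1 + 2 * ∑ j ∈ Finset.range k,
    (Polynomial.Chebyshev.T ℝ ((j + 1 : ℕ) : ℤ)).comp (1 - 2 * Polynomial.X ^ 2)

/-- The Jackson kernel `(sin ((2k+1)a) / ((2k+1) sin a))⁴` as a polynomial in `sin a`. -/
noncomputable def jacksonPoly (k : ℕ) : Polynomial ℝ :=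
  (Polynomial.C ((2 * k + 1 : ℝ)⁻¹) * dirichletPoly k) ^ 4

theorem dirichletPoly_eval_sin (k : ℕ) (a : ℝ) :
    (dirichletPoly k).eval (Real.sin a) =
      1 + 2 * ∑ j ∈ Finset.range k, Real.cos (2 * (j + 1) * a) := by
  have h : (1 : ℝ) - 2 * Real.sin a ^ 2 = Real.cos (2 * a) := by
    rw [Real.cos_two_mul, Real.cos_sq']; ring
  simp only [dirichletPoly, Polynomial.eval_add, Polynomial.eval_one, Polynomial.eval_mul,
    Polynomial.eval_ofNat, Polynomial.eval_finsetSum, Polynomial.eval_comp, Polynomial.eval_sub,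
    Polynomial.eval_pow, Polynomial.eval_X, h, Polynomial.Chebyshev.T_real_cos]
  congr 2
  refine Finset.sum_congr rfl fun j _ => ?_
  congr 1
  push_cast
  ring

/-- Telescoping: `2 cos(2(j+1)a) sin a = sin((2j+3)a) - sin((2j+1)a)`. -/
theorem dirichletPoly_eval_sin_mul_sin (k : ℕ) (a : ℝ) :
    (dirichletPoly k).eval (Real.sin a) * Real.sin a = Real.sin ((2 * k + 1) * a) := by
  rw [dirichletPoly_eval_sin]
  induction k with
  | zero => simp
  | succ k ih =>
    rw [Finset.sum_range_succ]
    have e1 : (2 * ((k + 1 : ℕ) : ℝ) + 1) * a = 2 * (k + 1) * a + a := by push_cast; ring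
    have e2 : (2 * (k : ℝ) + 1) * a = 2 * (k + 1) * a - a := by ring
    rw [e2, Real.sin_sub] at ih
    rw [e1, Real.sin_add]
    linear_combination ih

theorem natDegree_dirichletPoly_le (k : ℕ) : (dirichletPoly k).natDegree ≤ 2 * k := by
  unfold dirichletPoly
  refine (Polynomial.natDegree_add_le _ _).trans (max_le (by simp) ?_)
  have h2 : (2 : Polynomial ℝ) = Polynomial.C 2 := rfl
  conv_lhs => rw [h2]
  refine (Polynomial.natDegree_C_mul_le _ _).trans ?_
  refine Polynomial.natDegree_sum_le_of_forall_le _ _ fun j hj => ?_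
  refine Polynomial.natDegree_comp_le.trans ?_
  have hj' := Finset.mem_range.1 hj
  have e : (1 - 2 * Polynomial.X ^ 2 : Polynomial ℝ).natDegree ≤ 2 := by
    compute_degree
  have d : (Polynomial.Chebyshev.T ℝ ((j + 1 : ℕ) : ℤ)).natDegree ≤ j + 1 := by
    rw [Polynomial.Chebyshev.natDegree_T, Int.natAbs_natCast]
  calc _ ≤ (j + 1) * 2 := Nat.mul_le_mul d e
    _ ≤ 2 * k := by omega

theorem natDegree_jacksonPoly_le (k : ℕ) : (jacksonPoly k).natDegree ≤ 8 * k := by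
  unfold jacksonPoly
  refine Polynomial.natDegree_pow_le.trans ?_
  have := (Polynomial.natDegree_C_mul_le ((2 * k + 1 : ℝ)⁻¹) (dirichletPoly k)).trans
    (natDegree_dirichletPoly_le k)
  omega

theorem jacksonPoly_eval (k : ℕ) (s : ℝ) :
    (jacksonPoly k).eval s = ((dirichletPoly k).eval s / (2 * k + 1)) ^ 4 := by
  simp [jacksonPoly, div_eq_inv_mul]

theorem jacksonPoly_nonneg (k : ℕ) (s : ℝ) : 0 ≤ (jacksonPoly k).eval s := by
  rw [jacksonPoly_eval]; positivity

theorem jacksonPoly_eval_zero (k : ℕ) : (jacksonPoly k).eval 0 = 1 := by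
  have h := dirichletPoly_eval_sin k 0
  simp only [Real.sin_zero, mul_zero, Real.cos_zero, Finset.sum_const, Finset.card_range,
    nsmul_eq_mul, mul_one] at h
  rw [jacksonPoly_eval, h, add_comm, div_self (by positivity), one_pow]

theorem exists_sin_eq_of_abs_le_one {s : ℝ} (hs : |s| ≤ 1) : ∃ a, Real.sin a = s :=
  ⟨Real.arcsin s, Real.sin_arcsin (abs_le.1 hs).1 (abs_le.1 hs).2⟩

theorem abs_dirichletPoly_eval_le (k : ℕ) {s : ℝ} (hs : |s| ≤ 1) :
    |(dirichletPoly k).eval s| ≤ 2 * k + 1 := by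
  obtain ⟨a, rfl⟩ := exists_sin_eq_of_abs_le_one hs
  rw [dirichletPoly_eval_sin]
  have h : |∑ j ∈ Finset.range k, Real.cos (2 * (j + 1) * a)| ≤ k := by
    refine (Finset.abs_sum_le_sum_abs _ _).trans ?_
    refine (Finset.sum_le_sum fun j _ => Real.abs_cos_le_one _).trans ?_
    simp
  rw [abs_le] at h ⊢
  constructor <;> linarith [h.1, h.2]

theorem jacksonPoly_le_one (k : ℕ) {s : ℝ} (hs : |s| ≤ 1) : (jacksonPoly k).eval s ≤ 1 := by
  rw [jacksonPoly_eval, ← (show Even 4 by decide).pow_abs]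
  refine pow_le_one₀ (abs_nonneg _) ?_
  rw [abs_div, abs_of_nonneg (by positivity : (0 : ℝ) ≤ 2 * k + 1), div_le_one (by positivity)]
  exact abs_dirichletPoly_eval_le k hs

theorem jacksonPoly_mul_le_one (k : ℕ) {s : ℝ} (hs : |s| ≤ 1) :
    (jacksonPoly k).eval s * ((2 * k + 1) * s) ^ 4 ≤ 1 := by
  obtain ⟨a, rfl⟩ := exists_sin_eq_of_abs_le_one hs
  have hm : (2 * k + 1 : ℝ) ≠ 0 := by positivity
  have : (jacksonPoly k).eval (Real.sin a) * ((2 * k + 1) * Real.sin a) ^ 4 =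
      |Real.sin ((2 * k + 1) * a)| ^ 4 := by
    rw [(show Even 4 by decide).pow_abs, jacksonPoly_eval, ← dirichletPoly_eval_sin_mul_sin,
      ← mul_pow]
    congr 1
    field_simp
  rw [this]
  exact pow_le_one₀ (abs_nonneg _) (Real.abs_sin_le_one _)

/-- With `g` the kernel value and `u = (2k+1)s`, the bounds `g ≤ 1` and `g u⁴ ≤ 1` combine through
`(1+u²)² ≤ 2(1+u⁴)`. The squared Lorentzian leaves one factor to absorb a multiplier `s` or `s²` and
one factor to integrate. -/
theorem jacksonPoly_le (k : ℕ) {s : ℝ} (hs : |s| ≤ 1) :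
    (jacksonPoly k).eval s ≤ 4 / (1 + ((2 * k + 1) * s) ^ 2) ^ 2 := by
  rw [le_div_iff₀ (by positivity)]
  have h1 := jacksonPoly_le_one k hs
  have h2 := jacksonPoly_mul_le_one k hs
  have h0 := jacksonPoly_nonneg k s
  set g := (jacksonPoly k).eval s
  set u := (2 * k + 1) * s
  nlinarith [mul_nonneg h0 (sq_nonneg (u ^ 2 - 1))]

/-- For such `s = sin a` one has `|a| ≤ 2|s|`, so every angle in the cosine sum is at most `1` in
absolute value and every cosine is at least `1/2`. The normalized sum is then at least `1/2`, and
its fourth power at least `1/16`. -/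
theorem le_jacksonPoly (k : ℕ) {s : ℝ} (hs : |s| ≤ 1 / (2 * (2 * k + 1))) :
    1 / 16 ≤ (jacksonPoly k).eval s := by
  have hm : (1 : ℝ) ≤ 2 * k + 1 := by simp
  have hs1 : |s| ≤ 1 := hs.trans (by rw [div_le_one (by positivity)]; linarith)
  set a := Real.arcsin s with ha
  have hsin : Real.sin a = s := Real.sin_arcsin (abs_le.1 hs1).1 (abs_le.1 hs1).2
  have hab : |a| ≤ Real.pi / 2 := 
    abs_le.2 ⟨Real.neg_pi_div_two_le_arcsin s, Real.arcsin_le_pi_div_two s⟩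
  have h1 : |a| ≤ 2 * |s| := by
    have := Real.mul_abs_le_abs_sin hab
    rw [hsin] at this
    have hpi := Real.pi_le_four
    have : |a| ≤ Real.pi / 2 * |s| := by
      calc |a| = Real.pi / 2 * (2 / Real.pi * |a|) := by field_simp
        _ ≤ _ := by gcongr
    nlinarith [abs_nonneg s]
  have h2 : (2 * k + 1) * |a| ≤ 1 := by
    calc (2 * k + 1) * |a| ≤ (2 * k + 1) * (2 * (1 / (2 * (2 * k + 1)))) := by gcongr; linarith
      _ = 1 := by field_simp
  have h3 : (k : ℝ) * (1 / 2) ≤ ∑ j ∈ Finset.range k, Real.cos (2 * (j + 1) * a) := by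
    have : ∑ j ∈ Finset.range k, (1 / 2 : ℝ) = k * (1 / 2) := by simp
    rw [← this]
    refine Finset.sum_le_sum fun j hj => ?_
    have hj' : (j : ℝ) + 1 ≤ k := by exact_mod_cast Finset.mem_range.1 hj
    have hu : |2 * (j + 1) * a| ≤ 1 := by
      rw [abs_mul, abs_of_nonneg (by positivity : (0 : ℝ) ≤ 2 * (j + 1))]
      refine le_trans ?_ h2
      gcongr
      linarith
    have hu2 : (2 * (j + 1) * a) ^ 2 ≤ 1 := (sq_le_one_iff_abs_le_one _).2 hu
    linarith [Real.one_sub_sq_div_two_le_cos (x := 2 * (j + 1) * a)]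
  rw [jacksonPoly_eval, ← hsin, dirichletPoly_eval_sin]
  have h4 : (1 / 2 : ℝ) ≤
      (1 + 2 * ∑ j ∈ Finset.range k, Real.cos (2 * (j + 1) * a)) / (2 * k + 1) := by
    rw [le_div_iff₀ (by positivity)]
    linarith
  calc (1 / 16 : ℝ) = (1 / 2) ^ 4 := by norm_num
    _ ≤ _ := by gcongr

/-! ### Lorentzian majorants and the one-variable endpoint kernel -/

theorem integrable_lorentzian {m : ℝ} (hm : m ≠ 0) (c : ℝ) :
    Integrable fun s : ℝ => (1 + (m * (s - c)) ^ 2)⁻¹ :=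
  ((integrable_inv_one_add_sq.comp_mul_left' hm).comp_sub_right c)

theorem integral_lorentzian {m : ℝ} (hm : 0 < m) (c : ℝ) :
    ∫ s : ℝ, (1 + (m * (s - c)) ^ 2)⁻¹ = Real.pi / m := by
  rw [integral_sub_right_eq_self (fun s : ℝ => (1 + (m * s) ^ 2)⁻¹) c,
    Measure.integral_comp_mul_left (fun s : ℝ => (1 + s ^ 2)⁻¹) m, integral_univ_inv_one_add_sq,
    smul_eq_mul, abs_of_pos (inv_pos.2 hm)]
  ring

/-- A polynomial in `s ^ 2` equal to `p s + p (-s)`. -/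
theorem exists_eval_sq_eq (p : Polynomial ℝ) :
    ∃ q : Polynomial ℝ, q.natDegree ≤ p.natDegree / 2 ∧
      ∀ s : ℝ, q.eval (s ^ 2) = p.eval s + p.eval (-s) := by
  refine ⟨∑ i ∈ Finset.range (p.natDegree / 2 + 1),
    Polynomial.C (2 * p.coeff (2 * i)) * Polynomial.X ^ i, ?_, fun s => ?_⟩
  · refine Polynomial.natDegree_sum_le_of_forall_le _ _ fun i hi => ?_
    exact (Polynomial.natDegree_C_mul_X_pow_le _ _).trans
      (Nat.lt_succ_iff.1 (Finset.mem_range.1 hi))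
  -- The number of terms is made even so that the induction adds an even and an odd power at a time;
  -- the odd one cancels.
  · rw [Polynomial.eval_eq_sum_range' (p := p) (n := 2 * (p.natDegree / 2 + 1)) (by omega) s,
      Polynomial.eval_eq_sum_range' (p := p) (n := 2 * (p.natDegree / 2 + 1)) (by omega) (-s),
      ← Finset.sum_add_distrib, Polynomial.eval_finsetSum]
    generalize p.natDegree / 2 + 1 = N
    induction N with
    | zero => simp
    | succ N ih =>
      rw [Finset.sum_range_succ, ih, show 2 * (N + 1) = 2 * N + 1 + 1 by ring,
        Finset.sum_range_succ, Finset.sum_range_succ]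
      have h1 : (-s) ^ (2 * N) = s ^ (2 * N) := (even_two_mul N).neg_pow s
      have h2 : (-s) ^ (2 * N + 1) = -s ^ (2 * N + 1) := (odd_two_mul_add_one N).neg_pow s
      simp only [Polynomial.eval_mul, Polynomial.eval_C, Polynomial.eval_pow, Polynomial.eval_X,
        h1, h2, ← pow_mul]
      ring

/-- The factor `s` is the Jacobian of `y = s²`. With `m = 2k+1` and `u = (s-c)/2`, one has `s ≤ b +
2|u|` and `m|u| ≤ 1 + (mu)²`, so `s` is absorbed by one of the two Lorentzian factors. -/
theorem mul_jacksonPoly_le (k : ℕ) {s b : ℝ} (hs : 0 ≤ s) (hb : 0 ≤ b) {c : ℝ} (hc : |c| = b)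
    (h : |(s - c) / 2| ≤ 1) :
    s * (jacksonPoly k).eval ((s - c) / 2) ≤
      4 * (b + 2 / (2 * k + 1)) * (1 + (((2 * k + 1) / 2) * (s - c)) ^ 2)⁻¹ := by
  have hm : (0 : ℝ) < 2 * k + 1 := by positivity
  have h1 := jacksonPoly_le k h
  set u := (s - c) / 2 with hu
  set m : ℝ := 2 * k + 1 with hm'
  have e : m / 2 * (s - c) = m * u := by rw [hu]; ring
  rw [e]
  have hsu : s ≤ b + 2 * |u| := by
    have h2 : |s - c| = 2 * |u| := by rw [hu, abs_div, abs_two]; ring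
    have h3 := le_abs_self (s - c)
    have h4 := le_abs_self c
    linarith
  have hmu : m * |u| ≤ 1 + (m * u) ^ 2 := by
    have h5 : (m * u) ^ 2 = (m * |u|) ^ 2 := by rw [mul_pow, mul_pow, sq_abs]
    rw [h5]
    nlinarith [sq_nonneg (m * |u| - 1)]
  have hL : s ≤ (b + 2 / m) * (1 + (m * u) ^ 2) := by
    have h6 : |u| ≤ (1 + (m * u) ^ 2) / m := by rw [le_div_iff₀ hm]; linarith
    have h7 : b ≤ b * (1 + (m * u) ^ 2) := by nlinarith [mul_nonneg hb (sq_nonneg (m * u))]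
    calc s ≤ b + 2 * |u| := hsu
      _ ≤ b * (1 + (m * u) ^ 2) + 2 * ((1 + (m * u) ^ 2) / m) := by linarith
      _ = _ := by ring
  have hL0 : (0 : ℝ) < 1 + (m * u) ^ 2 := by positivity
  calc s * (jacksonPoly k).eval u ≤ s * (4 / (1 + (m * u) ^ 2) ^ 2) := by gcongr
    _ ≤ ((b + 2 / m) * (1 + (m * u) ^ 2)) * (4 / (1 + (m * u) ^ 2) ^ 2) := by gcongr
    _ = _ := by field_simp

/-- A nonnegative polynomial on `[0, 1]` peaked at `b ^ 2`, at the scale `b / k + 1 / k ^ 2`. -/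
theorem exists_endpoint_kernel (k : ℕ) {b : ℝ} (hb0 : 0 ≤ b) (hb1 : b ≤ 1) :
    ∃ q : Polynomial ℝ, q.natDegree ≤ 4 * k ∧ (∀ y ∈ Set.Icc (0 : ℝ) 1, 0 ≤ q.eval y) ∧
      1 ≤ q.eval (b ^ 2) ∧
      ∫ y in Set.Icc (0 : ℝ) 1, q.eval y ≤
        256 * ((b + 1 / (2 * k + 1)) / (2 * k + 1)) := by
  have hm : (0 : ℝ) < 2 * k + 1 := by positivity
  -- Symmetrizing in `s` makes the kernel a polynomial in `y = s²` of half the degree. The argument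
  -- is halved so that both `(s-b)/2` and `(s+b)/2` stay in `[-1, 1]`.
  obtain ⟨q, hqd, hq⟩ := exists_eval_sq_eq
    ((jacksonPoly k).comp (Polynomial.C (1 / 2) * (Polynomial.X - Polynomial.C b)))
  have hev : ∀ s : ℝ, q.eval (s ^ 2) =
      (jacksonPoly k).eval ((s - b) / 2) + (jacksonPoly k).eval ((-s - b) / 2) := by
    intro s
    rw [hq]
    simp only [Polynomial.eval_comp, Polynomial.eval_mul, Polynomial.eval_C, Polynomial.eval_sub,
      Polynomial.eval_X]
    congr 2 <;> ring
  refine ⟨q, ?_, fun y hy => ?_, ?_, ?_⟩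
  · refine hqd.trans ?_
    have h1 : ((jacksonPoly k).comp
        (Polynomial.C (1 / 2) * (Polynomial.X - Polynomial.C b))).natDegree ≤ 8 * k := by
      refine Polynomial.natDegree_comp_le.trans ?_
      have h2 : (Polynomial.C (1 / 2 : ℝ) * (Polynomial.X - Polynomial.C b)).natDegree ≤ 1 := by
        refine (Polynomial.natDegree_C_mul_le _ _).trans ?_
        simp
      calc _ ≤ 8 * k * 1 := Nat.mul_le_mul (natDegree_jacksonPoly_le k) h2
        _ = 8 * k := mul_one _
    omega
  · rw [← Real.sq_sqrt hy.1, hev]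
    exact add_nonneg (jacksonPoly_nonneg _ _) (jacksonPoly_nonneg _ _)
  · rw [hev, sub_self, zero_div, jacksonPoly_eval_zero]
    linarith [jacksonPoly_nonneg k ((-b - b) / 2)]
  · have hsub : ∫ s in (0 : ℝ)..1, q.eval (s ^ 2) * (2 * s) = ∫ y in (0 : ℝ)..1, q.eval y := by
      have := intervalIntegral.integral_comp_mul_deriv (a := 0) (b := 1) (f := fun s : ℝ => s ^ 2)
        (f' := fun s => 2 * s) (g := fun y => q.eval y)
        (fun s _ => by simpa using hasDerivAt_pow 2 s) (by fun_prop) (by fun_prop)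
      simpa using this
    rw [integral_Icc_eq_integral_Ioc, ← intervalIntegral.integral_of_le zero_le_one, ← hsub,
      intervalIntegral.integral_of_le zero_le_one, ← integral_Icc_eq_integral_Ioc]
    -- The `4` of `mul_jacksonPoly_le` times the `2` of the Jacobian `2s`.
    set B : ℝ := 8 * (b + 2 / (2 * k + 1))
    set L : ℝ → ℝ → ℝ := fun c s => (1 + (((2 * k + 1) / 2) * (s - c)) ^ 2)⁻¹
    have hm2 : (0 : ℝ) < (2 * k + 1) / 2 := by positivity
    have hLi : ∀ c, Integrable (L c) := fun c => integrable_lorentzian hm2.ne' c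
    have hmaj : Integrable fun s => B * L b s + B * L (-b) s :=
      ((hLi b).const_mul B).add ((hLi (-b)).const_mul B)
    -- Evenness turns the reflected kernel into a translate centred at `-b`.
    have hsymm : ∀ x, (jacksonPoly k).eval (-x) = (jacksonPoly k).eval x := by
      intro x
      simp [jacksonPoly, dirichletPoly, Polynomial.eval_finsetSum]
    calc ∫ s in Set.Icc (0 : ℝ) 1, q.eval (s ^ 2) * (2 * s)
        ≤ ∫ s in Set.Icc (0 : ℝ) 1, (B * L b s + B * L (-b) s) := by
          refine setIntegral_mono_on ?_ hmaj.integrableOn measurableSet_Icc fun s hs => ?_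
          · exact (Continuous.continuousOn (by fun_prop)).integrableOn_compact isCompact_Icc
          · have h1 := mul_jacksonPoly_le k hs.1 hb0 (abs_of_nonneg hb0)
              (by rw [abs_le]; constructor <;> linarith [hs.1, hs.2])
            have h2 := mul_jacksonPoly_le k hs.1 hb0 (c := -b) (by rw [abs_neg, abs_of_nonneg hb0])
              (by rw [abs_le]; constructor <;> linarith [hs.1, hs.2])
            rw [hev, ← hsymm ((-s - b) / 2), show -((-s - b) / 2) = (s - -b) / 2 by ring]
            simp only [B, L]
            linarith
      _ ≤ ∫ s, (B * L b s + B * L (-b) s) := by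
          refine setIntegral_le_integral hmaj (Eventually.of_forall fun s => ?_)
          simp only [B, L, Pi.zero_apply]
          positivity
      _ = B * (Real.pi / ((2 * k + 1) / 2)) + B * (Real.pi / ((2 * k + 1) / 2)) := by
          rw [integral_add ((hLi b).const_mul B) ((hLi (-b)).const_mul B), integral_const_mul,
            integral_const_mul, integral_lorentzian hm2, integral_lorentzian hm2]
      _ = Real.pi * (32 * (b + 2 / (2 * k + 1)) / (2 * k + 1)) := by
          simp only [B]; field_simp; ring
      _ ≤ 4 * (32 * (b + 2 / (2 * k + 1)) / (2 * k + 1)) := by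
          gcongr; exact Real.pi_le_four
      _ ≤ _ := by
          rw [mul_div_assoc, ← mul_assoc]
          have h1 : (0 : ℝ) ≤ b / (2 * k + 1) := by positivity
          calc _ = 128 * (b / (2 * k + 1)) + 256 * (1 / (2 * k + 1) / (2 * k + 1)) := by ring
            _ ≤ 256 * (b / (2 * k + 1)) + 256 * (1 / (2 * k + 1) / (2 * k + 1)) := by linarith
            _ = _ := by ring

/-! ### Geometry and measure of the simplex -/

section Simplex

variable {n : ℕ}

@[simp]
theorem barycentric_zero (x : EuclideanSpace ℝ (Fin n)) : barycentric x 0 = 1 - ∑ i, x i := rfl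

@[simp]
theorem barycentric_succ (x : EuclideanSpace ℝ (Fin n)) (i : Fin n) :
    barycentric x i.succ = x i := rfl

theorem sum_barycentric (x : EuclideanSpace ℝ (Fin n)) : ∑ k, barycentric x k = 1 := by
  simp [Fin.sum_univ_succ]

theorem continuous_barycentric (k : Fin (n + 1)) :
    Continuous fun x : EuclideanSpace ℝ (Fin n) => barycentric x k := by
  cases k using Fin.cases <;> simp only [barycentric_zero, barycentric_succ] <;> fun_prop

theorem barycentric_le_one {x : EuclideanSpace ℝ (Fin n)} (hx : x ∈ solidSimplex n)
    (k : Fin (n + 1)) : barycentric x k ≤ 1 := by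
  rw [← sum_barycentric x]
  exact Finset.single_le_sum (fun i _ => hx i) (Finset.mem_univ k)

theorem barycentric_mem_Icc {x : EuclideanSpace ℝ (Fin n)} (hx : x ∈ solidSimplex n)
    (k : Fin (n + 1)) : barycentric x k ∈ Set.Icc (0 : ℝ) 1 := ⟨hx k, barycentric_le_one hx k⟩

theorem abs_sub_le_one_of_mem_solidSimplex {x y : EuclideanSpace ℝ (Fin n)}
    (hx : x ∈ solidSimplex n) (hy : y ∈ solidSimplex n) (i : Fin n) : |x i - y i| ≤ 1 := by
  have h1 := barycentric_mem_Icc hx i.succ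
  have h2 := barycentric_mem_Icc hy i.succ
  rw [barycentric_succ] at h1 h2
  rw [abs_le]
  constructor <;> linarith [h1.1, h1.2, h2.1, h2.2]

theorem exists_inv_le_barycentric (x : EuclideanSpace ℝ (Fin n)) :
    ∃ k, 1 / (n + 1 : ℝ) ≤ barycentric x k := by
  by_contra! h
  have := Finset.sum_lt_sum_of_nonempty Finset.univ_nonempty (fun k _ => h k)
  rw [sum_barycentric] at this
  simp only [Finset.sum_const, Finset.card_univ, Fintype.card_fin, nsmul_eq_mul] at this
  push_cast at this
  rw [mul_one_div_cancel (by positivity)] at this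
  exact lt_irrefl _ this

theorem abs_barycentric_sub_le (x y : EuclideanSpace ℝ (Fin n)) (k : Fin (n + 1)) :
    |barycentric x k - barycentric y k| ≤ (n + 1) * dist x y := by
  have h : ∀ i, |x i - y i| ≤ dist x y := fun i => by
    rw [dist_eq_norm]
    exact PiLp.norm_apply_le (x - y) i
  cases k using Fin.cases with
  | zero =>
    have e : barycentric x 0 - barycentric y 0 = ∑ i, (y i - x i) := by
      rw [Finset.sum_sub_distrib]; simp
    rw [e]
    refine (Finset.abs_sum_le_sum_abs _ _).trans ?_
    calc ∑ i, |y i - x i| ≤ ∑ _i : Fin n, dist x y :=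
          Finset.sum_le_sum fun i _ => by rw [abs_sub_comm]; exact h i
      _ = n * dist x y := by simp
      _ ≤ _ := by nlinarith [dist_nonneg (x := x) (y := y)]
  | succ i =>
    refine (h i).trans ?_
    nlinarith [dist_nonneg (x := x) (y := y), Nat.cast_nonneg (α := ℝ) n]

theorem isClosed_solidSimplex (n : ℕ) : IsClosed (solidSimplex n) := by
  rw [solidSimplex, Set.ofPred_forall]
  exact isClosed_iInter fun k => isClosed_le continuous_const (continuous_barycentric k)

theorem isBounded_solidSimplex (n : ℕ) : Bornology.IsBounded (solidSimplex n) := by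
  rw [Metric.isBounded_iff]
  refine ⟨Real.sqrt n, fun x hx y hy => ?_⟩
  rw [EuclideanSpace.dist_eq]
  refine Real.sqrt_le_sqrt ?_
  calc ∑ i, dist (x i) (y i) ^ 2 ≤ ∑ _i : Fin n, (1 : ℝ) := Finset.sum_le_sum fun i _ => by
        rw [Real.dist_eq]
        exact pow_le_one₀ (abs_nonneg _) (abs_sub_le_one_of_mem_solidSimplex hx hy i)
    _ = n := by simp

theorem isCompact_solidSimplex (n : ℕ) : IsCompact (solidSimplex n) :=
  Metric.isCompact_of_isClosed_isBounded (isClosed_solidSimplex n) (isBounded_solidSimplex n)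

theorem volume_solidSimplex_ne_top (n : ℕ) : volume (solidSimplex n) ≠ ∞ :=
  (isCompact_solidSimplex n).measure_lt_top.ne

theorem volume_solidSimplex_pos (n : ℕ) : 0 < volume (solidSimplex n) := by
  have ho : IsOpen {x : EuclideanSpace ℝ (Fin n) | ∀ k, 0 < barycentric x k} := by
    rw [Set.ofPred_forall]
    exact isOpen_iInter_of_finite fun k => isOpen_lt continuous_const (continuous_barycentric k)
  refine (ho.measure_pos volume ⟨WithLp.toLp 2 fun _ => 1 / (n + 1), fun k => ?_⟩).trans_le
    (measure_mono fun x hx k => (hx k).le)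
  have hn : (0 : ℝ) < n + 1 := by positivity
  cases k using Fin.cases with
  | zero =>
    have : 1 - (n : ℝ) * (1 / (n + 1)) = 1 / (n + 1) := by field_simp; ring
    simp only [barycentric_zero, Finset.sum_const, Finset.card_univ, Fintype.card_fin,
      nsmul_eq_mul]
    rw [this]
    positivity
  | succ i =>
    simp only [barycentric_succ]
    positivity

theorem volume_real_solidSimplex_pos (n : ℕ) : 0 < volume.real (solidSimplex n) :=
  ENNReal.toReal_pos (volume_solidSimplex_pos n).ne' (volume_solidSimplex_ne_top n)

theorem integral_simplexMeasure (f : EuclideanSpace ℝ (Fin n) → ℝ) :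
    ∫ x, f x ∂simplexMeasure n =
      (volume.real (solidSimplex n))⁻¹ * ∫ x in solidSimplex n, f x := by
  rw [simplexMeasure, integral_smul_measure, ENNReal.toReal_inv, smul_eq_mul, Measure.real]

theorem support_simplexMeasure_subset (n : ℕ) : (simplexMeasure n).support ⊆ solidSimplex n := by
  refine Measure.support_subset_of_isClosed (isClosed_solidSimplex n) ?_
  rw [mem_ae_iff, simplexMeasure, Measure.smul_apply,
    Measure.restrict_apply (isClosed_solidSimplex n).measurableSet.compl]
  simp

theorem WeightedPoints.mem_solidSimplex {F : WeightedPoints n}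
    (h : F.IsInterior (simplexMeasure n) ∨ F.IsBoundary (simplexMeasure n)) :
    ∀ p ∈ F.points, p ∈ solidSimplex n := fun p hp =>
  support_simplexMeasure_subset n (h.elim (fun h => interior_subset (h p hp)) fun h => h.1 p hp)

/-- An upper bound suffices because this measure stands in the denominator of the density, so the
part of the ball outside the simplex may be counted too. -/
theorem simplexMeasure_ball_le (x : EuclideanSpace ℝ (Fin n)) {r : ℝ} (hr : 0 < r) :
    simplexMeasure n (Metric.ball x r) ≤ ENNReal.ofReal (r ^ n *
      ((volume.real (solidSimplex n))⁻¹ *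
        volume.real (Metric.ball (0 : EuclideanSpace ℝ (Fin n)) 1))) := by
  rw [simplexMeasure, Measure.smul_apply, smul_eq_mul]
  have h1 : (volume.restrict (solidSimplex n)) (Metric.ball x r) ≤
      ENNReal.ofReal (r ^ n) * volume (Metric.ball (0 : EuclideanSpace ℝ (Fin n)) 1) := by
    refine (Measure.restrict_apply_le _ _).trans ?_
    rw [Measure.addHaar_ball_of_pos _ _ hr, finrank_euclideanSpace, Fintype.card_fin]
  refine (mul_le_mul_right h1 _).trans (le_of_eq ?_)
  rw [ENNReal.ofReal_mul (by positivity), ENNReal.ofReal_mul (by positivity),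
    ENNReal.ofReal_inv_of_pos (volume_real_solidSimplex_pos n), Measure.real, Measure.real,
    ENNReal.ofReal_toReal (volume_solidSimplex_ne_top n),
    ENNReal.ofReal_toReal measure_ball_lt_top.ne]
  ring

/-! ### Barycentric polynomials, charts and product integrals -/

/-- The barycentric coordinates as polynomials. -/
noncomputable def barycentricPoly (n : ℕ) : Fin (n + 1) → MvPolynomial (Fin n) ℝ :=
  Fin.cons (1 - ∑ i, MvPolynomial.X i) MvPolynomial.X

theorem eval_barycentricPoly (x : EuclideanSpace ℝ (Fin n)) (k : Fin (n + 1)) :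
    MvPolynomial.eval (fun i => x i) (barycentricPoly n k) = barycentric x k := by
  cases k using Fin.cases <;> simp [barycentricPoly]

theorem totalDegree_barycentricPoly_le (k : Fin (n + 1)) :
    (barycentricPoly n k).totalDegree ≤ 1 := by
  cases k using Fin.cases with
  | zero =>
    refine (MvPolynomial.totalDegree_sub _ _).trans (max_le (by simp) ?_)
    exact MvPolynomial.totalDegree_finsetSum_le fun i _ => (MvPolynomial.totalDegree_X i).le
  | succ i => exact (MvPolynomial.totalDegree_X i).le

theorem totalDegree_aeval_le {σ : Type*} {p : MvPolynomial σ ℝ} (hp : p.totalDegree ≤ 1)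
    (q : Polynomial ℝ) : (Polynomial.aeval p q).totalDegree ≤ q.natDegree := by
  rw [Polynomial.aeval_eq_sum_range]
  refine MvPolynomial.totalDegree_finsetSum_le fun i hi => ?_
  refine (MvPolynomial.totalDegree_smul_le _ _).trans ((MvPolynomial.totalDegree_pow _ _).trans ?_)
  have := Finset.mem_range.1 hi
  nlinarith

theorem eval_aeval {σ : Type*} (p : MvPolynomial σ ℝ) (q : Polynomial ℝ) (x : σ → ℝ) :
    MvPolynomial.eval x (Polynomial.aeval p q) = q.eval (MvPolynomial.eval x p) := by
  rw [← MvPolynomial.coe_aeval_eq_eval]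
  exact (Polynomial.aeval_algHom_apply (MvPolynomial.aeval x) p q).symm

/-- All barycentric coordinates except the `k`-th, the zeroth in place of the `k`-th. -/
def barycentricChart (k : Fin (n + 1)) (y : EuclideanSpace ℝ (Fin n)) : Fin n → ℝ :=
  fun i => barycentric y (Equiv.swap 0 k i.succ)

/-- The linear part of a barycentric coordinate. -/
def barycentricLinear (n : ℕ) : Fin (n + 1) → (Fin n → ℝ) →ₗ[ℝ] ℝ :=
  Fin.cons (-∑ i, LinearMap.proj i) fun i => LinearMap.proj i

theorem sum_barycentricLinear (v : Fin n → ℝ) : ∑ k, barycentricLinear n k v = 0 := by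
  simp [Fin.sum_univ_succ, barycentricLinear]

/-- The linear part of `barycentricChart`. -/
def barycentricChartLinear (k : Fin (n + 1)) : (Fin n → ℝ) →ₗ[ℝ] (Fin n → ℝ) :=
  LinearMap.pi fun i => barycentricLinear n (Equiv.swap 0 k i.succ)

/-- The chart acts on the linear parts of the coordinates as a transposition. For `j = 0` this holds
because the linear parts sum to `0`. Consequently the linear chart is an involution. -/
theorem barycentricLinear_chartLinear (k j : Fin (n + 1)) (v : Fin n → ℝ) :
    barycentricLinear n j (barycentricChartLinear k v) =
      barycentricLinear n (Equiv.swap 0 k j) v := by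
  cases j using Fin.cases with
  | zero =>
    have h := sum_barycentricLinear v
    rw [← Equiv.sum_comp (Equiv.swap 0 k), Fin.sum_univ_succ] at h
    have e : barycentricLinear n 0 (barycentricChartLinear k v) =
        -∑ i : Fin n, barycentricLinear n (Equiv.swap 0 k i.succ) v := by
      simp [barycentricLinear, barycentricChartLinear]
    rw [e]
    linarith
  | succ i => rfl

theorem barycentricChartLinear_comp_self (k : Fin (n + 1)) :
    barycentricChartLinear k ∘ₗ barycentricChartLinear k = LinearMap.id := by
  refine LinearMap.ext fun v => funext fun i => ?_
  change barycentricLinear n (Equiv.swap 0 k i.succ) (barycentricChartLinear k v) = v i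
  rw [barycentricLinear_chartLinear, Equiv.swap_apply_self]
  rfl

theorem barycentric_eq_linear_add (y : EuclideanSpace ℝ (Fin n)) (j : Fin (n + 1)) :
    barycentric y j = barycentricLinear n j (WithLp.ofLp y) + if j = 0 then 1 else 0 := by
  cases j using Fin.cases with
  | zero => simp [barycentricLinear]; ring
  | succ i => simp [barycentricLinear]

/-- An involution has determinant `±1`; the remaining part of the chart is a translation. -/
theorem measurePreserving_barycentricChart (k : Fin (n + 1)) :
    MeasurePreserving (barycentricChart k) volume volume := by
  have hdet : LinearMap.det (barycentricChartLinear k) *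
      LinearMap.det (barycentricChartLinear k) = 1 := by
    rw [← LinearMap.det_comp, barycentricChartLinear_comp_self, LinearMap.det_id]
  have h0 : LinearMap.det (barycentricChartLinear k) ≠ 0 := left_ne_zero_of_mul_eq_one hdet
  have habs : |(LinearMap.det (barycentricChartLinear k))⁻¹| = 1 := by
    rw [abs_inv, inv_eq_one, ← sq_eq_sq₀ (abs_nonneg _) zero_le_one, sq_abs]
    linarith
  have hL : MeasurePreserving (barycentricChartLinear k) volume volume :=
    ⟨(barycentricChartLinear k).continuous_of_finiteDimensional.measurable, by
      rw [Measure.map_linearMap_addHaar_eq_smul_addHaar _ h0, habs]; simp⟩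
  have hT := measurePreserving_add_right (volume : Measure (Fin n → ℝ))
    (fun i => if Equiv.swap 0 k i.succ = 0 then 1 else 0)
  have := hT.comp (hL.comp (PiLp.volume_preserving_ofLp (Fin n)))
  exact (funext fun y => funext fun i => (barycentric_eq_linear_add y _).symm :
    _ = barycentricChart k) ▸ this

/-- The chart maps the simplex into the unit cube and preserves volume. Nonnegativity allows
enlarging the domain to the whole cube, where the product integral factorizes. -/
theorem setIntegral_solidSimplex_prod_le (k : Fin (n + 1)) {f : Fin n → ℝ → ℝ}
    (hf : ∀ i, Continuous (f i)) (h0 : ∀ i, ∀ s ∈ Set.Icc (0 : ℝ) 1, 0 ≤ f i s) :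
    ∫ y in solidSimplex n, ∏ i, f i (barycentric y (Equiv.swap 0 k i.succ)) ≤
      ∏ i, ∫ s in Set.Icc (0 : ℝ) 1, f i s := by
  set g : Fin n → ℝ → ℝ := fun i => (Set.Icc (0 : ℝ) 1).indicator (f i) with hg
  have hgi : ∀ i, Integrable (g i) := fun i =>
    ((hf i).continuousOn.integrableOn_compact isCompact_Icc).integrable_indicator measurableSet_Icc
  have hg0 : ∀ i s, 0 ≤ g i s := fun i s => Set.indicator_nonneg (h0 i) s
  have hprod : Integrable fun v : Fin n → ℝ => ∏ i, g i (v i) := Integrable.fintype_prod hgi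
  have hmp := measurePreserving_barycentricChart k
  calc ∫ y in solidSimplex n, ∏ i, f i (barycentric y (Equiv.swap 0 k i.succ))
      = ∫ y in solidSimplex n, ∏ i, g i (barycentricChart k y i) := by
        refine setIntegral_congr_fun (isClosed_solidSimplex n).measurableSet fun y hy => ?_
        refine Finset.prod_congr rfl fun i _ => ?_
        exact (Set.indicator_of_mem (barycentric_mem_Icc hy _) _).symm
    _ ≤ ∫ y, ∏ i, g i (barycentricChart k y i) :=
        setIntegral_le_integral (hmp.integrable_comp_of_integrable hprod)
          (Eventually.of_forall fun y => Finset.prod_nonneg fun i _ => hg0 i _)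
    _ = ∫ v : Fin n → ℝ, ∏ i, g i (v i) := by
        have h := integral_map hmp.measurable.aemeasurable
          (f := fun v : Fin n → ℝ => ∏ i, g i (v i))
          (by rw [hmp.map_eq]; exact hprod.aestronglyMeasurable)
        rw [hmp.map_eq] at h
        exact h.symm
    _ = ∏ i, ∫ s, g i s := integral_fintype_prod_volume_eq_prod g
    _ = _ := Finset.prod_congr rfl fun i _ => integral_indicator measurableSet_Icc

/-- Contracting the convex simplex towards `x` gives a subset near `x` of volume `l^n` times the
whole, even when `x` lies on the boundary. -/
theorem homothety_image_solidSimplex_subset {x : EuclideanSpace ℝ (Fin n)}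
    (hx : x ∈ solidSimplex n) {l : ℝ} (h0 : 0 ≤ l) (h1 : l ≤ 1) :
    AffineMap.homothety x l '' solidSimplex n ⊆
      {y | y ∈ solidSimplex n ∧ ∀ i, |y i - x i| ≤ l} := by
  rintro _ ⟨y, hy, rfl⟩
  have hc : ∀ i, (AffineMap.homothety x l y) i = (1 - l) * x i + l * y i := fun i => by
    simp [AffineMap.homothety_apply]; ring
  refine ⟨fun k => ?_, fun i => ?_⟩
  · have : barycentric (AffineMap.homothety x l y) k =
        (1 - l) * barycentric x k + l * barycentric y k := by
      cases k using Fin.cases with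
      | zero =>
        simp only [barycentric_zero, hc, Finset.sum_add_distrib, ← Finset.mul_sum]
        ring
      | succ i => simp only [barycentric_succ, hc]
    rw [this]
    exact add_nonneg (mul_nonneg (by linarith) (hx k)) (mul_nonneg h0 (hy k))
  · rw [hc, show (1 - l) * x i + l * y i - x i = l * (y i - x i) by ring, abs_mul,
      abs_of_nonneg h0]
    exact mul_le_of_le_one_right h0 (abs_sub_le_one_of_mem_solidSimplex hy hx i)

end Simplex

/-! ### Mass and second moment of the Jackson kernel -/

theorem setIntegral_le_of_le_lorentzian {f : ℝ → ℝ} (hf : Continuous f) {B m : ℝ} (hB : 0 ≤ B)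
    (hm : 0 < m) (c : ℝ)
    (h : ∀ s ∈ Set.Icc (0 : ℝ) 1, f s ≤ B * (1 + (m * (s - c)) ^ 2)⁻¹) :
    ∫ s in Set.Icc (0 : ℝ) 1, f s ≤ 4 * B / m := by
  have hi := (integrable_lorentzian hm.ne' c).const_mul B
  calc ∫ s in Set.Icc (0 : ℝ) 1, f s
      ≤ ∫ s in Set.Icc (0 : ℝ) 1, B * (1 + (m * (s - c)) ^ 2)⁻¹ :=
        setIntegral_mono_on (hf.continuousOn.integrableOn_compact isCompact_Icc) hi.integrableOn
          measurableSet_Icc h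
    _ ≤ ∫ s, B * (1 + (m * (s - c)) ^ 2)⁻¹ :=
        setIntegral_le_integral hi (Eventually.of_forall fun s => by
          simp only [Pi.zero_apply]; positivity)
    _ = B * (Real.pi / m) := by rw [integral_const_mul, integral_lorentzian hm]
    _ ≤ B * (4 / m) := by gcongr; exact Real.pi_le_four
    _ = _ := by ring

theorem setIntegral_jacksonPoly_le (k : ℕ) {c : ℝ} (hc : c ∈ Set.Icc (0 : ℝ) 1) :
    ∫ s in Set.Icc (0 : ℝ) 1, (jacksonPoly k).eval (s - c) ≤ 16 / (2 * k + 1) := by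
  have hm : (0 : ℝ) < 2 * k + 1 := by positivity
  refine (setIntegral_le_of_le_lorentzian (by fun_prop) (by norm_num : (0 : ℝ) ≤ 4) hm c
    fun s hs => ?_).trans (by norm_num)
  refine (jacksonPoly_le k (by rw [abs_le]; constructor <;> linarith [hs.1, hs.2, hc.1, hc.2])).trans
    ?_
  rw [div_eq_mul_inv]
  gcongr
  nlinarith [sq_nonneg ((2 * k + 1) * (s - c))]

/-- One Lorentzian factor absorbs `((2k+1)(s-c))²`, so the second moment gains `(2k+1)⁻²` over the
mass bound. -/
theorem setIntegral_jacksonPoly_mul_sq_le (k : ℕ) {c : ℝ} (hc : c ∈ Set.Icc (0 : ℝ) 1) :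
    ∫ s in Set.Icc (0 : ℝ) 1, (jacksonPoly k).eval (s - c) * (s - c) ^ 2 ≤
      16 / (2 * k + 1) * (1 / (2 * k + 1) ^ 2) := by
  have hm : (0 : ℝ) < 2 * k + 1 := by positivity
  refine (setIntegral_le_of_le_lorentzian (by fun_prop)
    (by positivity : (0 : ℝ) ≤ 4 / (2 * k + 1) ^ 2) hm c
    fun s hs => ?_).trans (le_of_eq (by field_simp; norm_num))
  have h := jacksonPoly_le k (s := s - c)
    (by rw [abs_le]; constructor <;> linarith [hs.1, hs.2, hc.1, hc.2])
  generalize s - c = u at *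
  set m : ℝ := 2 * k + 1
  calc (jacksonPoly k).eval u * u ^ 2 ≤ 4 / (1 + (m * u) ^ 2) ^ 2 * u ^ 2 := by gcongr
    _ = 4 / m ^ 2 * ((m * u) ^ 2 / (1 + (m * u) ^ 2) ^ 2) := by field_simp
    _ ≤ 4 / m ^ 2 * ((1 + (m * u) ^ 2) / (1 + (m * u) ^ 2) ^ 2) := by gcongr; linarith
    _ = _ := by field_simp

/-! ### Single weights and local mass of a cubature formula -/

section Cubature

variable {n : ℕ} {F : WeightedPoints n} {t : ℕ}

/-- Upper bound for the weights of a positive cubature formula on the simplex. -/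
theorem WeightedPoints.weight_le (hF : F.IsCubature (simplexMeasure n) t) (hpos : F.IsPositive)
    (hsub : ∀ p ∈ F.points, p ∈ solidSimplex n) {p : EuclideanSpace ℝ (Fin n)}
    (hp : p ∈ F.points) {k : ℕ} (hk : n * (4 * k) ≤ t) :
    F.weight p ≤ (volume.real (solidSimplex n))⁻¹ * (n + 1) * 256 ^ n / (2 * k + 1) ^ n *
      ∏ j, (Real.sqrt (barycentric p j) + 1 / (2 * k + 1)) := by
  have hpΔ := hsub p hp
  -- The kernel uses all coordinates but `j₀`; dropping one that is bounded below loses only a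
  -- factor `n + 1`.
  obtain ⟨j₀, hj₀⟩ := exists_inv_le_barycentric p
  have hker := fun i : Fin n => exists_endpoint_kernel k
    (Real.sqrt_nonneg (barycentric p (Equiv.swap 0 j₀ i.succ)))
    (Real.sqrt_le_one.2 (barycentric_le_one hpΔ _))
  choose q hqd hq0 hq1 hqi using hker
  set P : MvPolynomial (Fin n) ℝ :=
    ∏ i, Polynomial.aeval (barycentricPoly n (Equiv.swap 0 j₀ i.succ)) (q i) with hP
  have hPe : ∀ y : EuclideanSpace ℝ (Fin n), MvPolynomial.eval (fun i => y i) P =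
      ∏ i, (q i).eval (barycentric y (Equiv.swap 0 j₀ i.succ)) := fun y => by
    simp only [hP, map_prod, eval_aeval, eval_barycentricPoly]
  have hPd : P.totalDegree ≤ t := by
    refine (MvPolynomial.totalDegree_finsetProd _ _).trans (le_trans ?_ hk)
    refine (Finset.sum_le_sum fun i _ =>
      (totalDegree_aeval_le (totalDegree_barycentricPoly_le _) (q i)).trans (hqd i)).trans ?_
    simp
  have hP0 : ∀ y ∈ solidSimplex n, 0 ≤ MvPolynomial.eval (fun i => y i) P := fun y hy => by
    rw [hPe]
    exact Finset.prod_nonneg fun i _ => hq0 i _ (barycentric_mem_Icc hy _)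
  have hP1 : 1 ≤ MvPolynomial.eval (fun i => p i) P := by
    rw [hPe]
    refine le_trans (by simp) (Finset.prod_le_prod (f := fun _ : Fin n => (1 : ℝ))
      (fun _ _ => zero_le_one) fun i _ => ?_)
    have := hq1 i
    rwa [Real.sq_sqrt (hpΔ _)] at this
  have hm : (0 : ℝ) < 2 * k + 1 := by positivity
  have hint : ∫ y in solidSimplex n, MvPolynomial.eval (fun i => y i) P ≤
      256 ^ n / (2 * k + 1) ^ n * ∏ i : Fin n,
        (Real.sqrt (barycentric p (Equiv.swap 0 j₀ i.succ)) + 1 / (2 * k + 1)) := by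
    simp only [hPe]
    refine (setIntegral_solidSimplex_prod_le j₀ (fun i => (q i).continuous) hq0).trans ?_
    refine (Finset.prod_le_prod (fun i _ => setIntegral_nonneg measurableSet_Icc (hq0 i))
      fun i _ => hqi i).trans (le_of_eq ?_)
    simp only [Finset.prod_mul_distrib, Finset.prod_div_distrib, Finset.prod_const,
      Finset.card_univ, Fintype.card_fin]
    ring
  have hsplit : ∏ i : Fin n,
        (Real.sqrt (barycentric p (Equiv.swap 0 j₀ i.succ)) + 1 / (2 * k + 1)) ≤
      (n + 1) * ∏ j, (Real.sqrt (barycentric p j) + 1 / (2 * k + 1)) := by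
    rw [← Equiv.prod_comp (Equiv.swap 0 j₀)
      (fun j => Real.sqrt (barycentric p j) + 1 / (2 * k + 1 : ℝ)), Fin.prod_univ_succ,
      Equiv.swap_apply_left, ← mul_assoc]
    refine le_mul_of_one_le_left (Finset.prod_nonneg fun i _ => by positivity) ?_
    have h1 : barycentric p j₀ ≤ Real.sqrt (barycentric p j₀) := by
      refine Real.le_sqrt_of_sq_le ?_
      nlinarith [hpΔ j₀, barycentric_le_one hpΔ j₀]
    have h2 : (0 : ℝ) ≤ 1 / (2 * k + 1) := by positivity
    have h3 : (0 : ℝ) < n + 1 := by positivity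
    calc (1 : ℝ) = (n + 1) * (1 / (n + 1)) := by field_simp
      _ ≤ _ := by gcongr; linarith
  calc F.weight p ≤ F.weight p * MvPolynomial.eval (fun i => p i) P :=
        le_mul_of_one_le_right (hpos p hp).le hP1
    _ ≤ ∑ y ∈ F.points, F.weight y * MvPolynomial.eval (fun i => y i) P :=
        Finset.single_le_sum (f := fun y => F.weight y * MvPolynomial.eval (fun i => y i) P)
          (fun y hy => mul_nonneg (hpos y hy).le (hP0 y (hsub y hy))) hp
    _ = ∫ y, MvPolynomial.eval (fun i => y i) P ∂simplexMeasure n := (hF P hPd).symm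
    _ = (volume.real (solidSimplex n))⁻¹ *
        ∫ y in solidSimplex n, MvPolynomial.eval (fun i => y i) P := integral_simplexMeasure _
    _ ≤ (volume.real (solidSimplex n))⁻¹ * (256 ^ n / (2 * k + 1) ^ n *
        ((n + 1) * ∏ j, (Real.sqrt (barycentric p j) + 1 / (2 * k + 1)))) := by
        have := volume_real_solidSimplex_pos n
        gcongr
        exact hint.trans (by gcongr)
    _ = _ := by ring

/-- The integral over the simplex of the product kernel centred at `x` times
`1 - |y - x| ^ 2 / r ^ 2` has the order of the volume of a ball of radius `1 / (2k+1)`. -/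
theorem le_setIntegral_jackson_prod {x : EuclideanSpace ℝ (Fin n)} (hx : x ∈ solidSimplex n)
    {r : ℝ} (hr : 0 < r) (k : ℕ) :
    (volume.real (solidSimplex n) / 32 ^ n - n * 16 ^ n / ((2 * k + 1) * r) ^ 2) /
        (2 * k + 1) ^ n ≤
      ∫ y in solidSimplex n, (∏ i, (jacksonPoly k).eval (y i - x i)) *
        (1 - (r ^ 2)⁻¹ * ∑ i, (y i - x i) ^ 2) := by
  have hm : (0 : ℝ) < 2 * k + 1 := by positivity
  set K : EuclideanSpace ℝ (Fin n) → ℝ := fun y => ∏ i, (jacksonPoly k).eval (y i - x i) with hK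
  have hKc : Continuous K := by fun_prop
  have hK0 : ∀ y, 0 ≤ K y := fun y => Finset.prod_nonneg fun i _ => jacksonPoly_nonneg _ _
  have hint : ∀ f : EuclideanSpace ℝ (Fin n) → ℝ, Continuous f → IntegrableOn f (solidSimplex n) :=
    fun f hf => hf.continuousOn.integrableOn_compact (isCompact_solidSimplex n)
  have hmain : volume.real (solidSimplex n) / 32 ^ n / (2 * k + 1) ^ n ≤
      ∫ y in solidSimplex n, K y := by
    -- The scale at which `le_jacksonPoly` keeps every factor above `1/16`; with the `2` in `l` this
    -- produces `32 ^ n`.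
    set l : ℝ := 1 / (2 * (2 * k + 1)) with hl
    have hl0 : 0 ≤ l := by positivity
    have hl1 : l ≤ 1 := by
      rw [hl, div_le_one (by positivity)]
      linarith [Nat.cast_nonneg (α := ℝ) k]
    set S := AffineMap.homothety x l '' solidSimplex n
    have hS := homothety_image_solidSimplex_subset hx hl0 hl1
    have hSv : volume.real S = l ^ n * volume.real (solidSimplex n) := by
      rw [Measure.real, Measure.addHaar_image_homothety, finrank_euclideanSpace, Fintype.card_fin,
        abs_of_nonneg (by positivity), ENNReal.toReal_mul, ENNReal.toReal_ofReal (by positivity),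
        Measure.real]
    have hSc : IsCompact S :=
      (isCompact_solidSimplex n).image (AffineMap.homothety_continuous x l)
    calc volume.real (solidSimplex n) / 32 ^ n / (2 * k + 1) ^ n
        = (1 / 16) ^ n * volume.real S := by
          rw [hSv, hl, one_div_pow, one_div_pow, mul_pow,
            show (32 : ℝ) = 16 * 2 by norm_num, mul_pow]
          field_simp
      _ = ∫ _y in S, (1 / 16 : ℝ) ^ n := by simp [mul_comm, Measure.real]
      _ ≤ ∫ y in S, K y := by
          refine setIntegral_mono_on (integrableOn_const hSc.measure_lt_top.ne)
            (hKc.continuousOn.integrableOn_compact hSc) hSc.measurableSet fun y hy => ?_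
          have : ∏ _i : Fin n, (1 / 16 : ℝ) = (1 / 16) ^ n := by simp
          rw [← this]
          exact Finset.prod_le_prod (fun _ _ => by norm_num) fun i _ =>
            le_jacksonPoly k ((hS hy).2 i)
      _ ≤ _ := setIntegral_mono_set (hint K hKc) (Eventually.of_forall hK0)
          (Eventually.of_forall fun y hy => (hS hy).1)
  have hmom : ∀ i, ∫ y in solidSimplex n, K y * (y i - x i) ^ 2 ≤
      16 ^ n / (2 * k + 1) ^ n * (1 / (2 * k + 1) ^ 2) := by
    intro i
    -- The second moment in direction `i` is still a product, with the square in slot `i`. The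
    -- trivial swap below selects the Cartesian coordinates.
    set f : Fin n → ℝ → ℝ := fun l s =>
      (jacksonPoly k).eval (s - x l) * (if l = i then (s - x l) ^ 2 else 1) with hf
    have hf0 : ∀ l s, 0 ≤ f l s := fun l s => by
      refine mul_nonneg (jacksonPoly_nonneg _ _) ?_
      split_ifs <;> positivity
    have hfc : ∀ l, Continuous (f l) := fun l => by
      by_cases h : l = i <;> simp only [hf, h, if_true, if_false] <;> fun_prop
    have e : ∀ y : EuclideanSpace ℝ (Fin n), K y * (y i - x i) ^ 2 =
        ∏ l, f l (barycentric y (Equiv.swap 0 0 l.succ)) := fun y => by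
      simp only [hf, Equiv.swap_self, Equiv.refl_apply, barycentric_succ, Finset.prod_mul_distrib,
        Finset.prod_ite_eq', Finset.mem_univ, if_true, hK]
    simp only [e]
    refine (setIntegral_solidSimplex_prod_le 0 hfc fun l s _ => hf0 l s).trans ?_
    have hfb : ∀ l, ∫ s in Set.Icc (0 : ℝ) 1, f l s ≤
        16 / (2 * k + 1) * (if l = i then 1 / (2 * k + 1 : ℝ) ^ 2 else 1) := fun l => by
      have hxl : x l ∈ Set.Icc (0 : ℝ) 1 := barycentric_mem_Icc hx l.succ
      by_cases h : l = i
      · simp only [hf, h, if_true]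
        exact setIntegral_jacksonPoly_mul_sq_le k (h ▸ hxl)
      · simp only [hf, h, if_false, mul_one]
        exact setIntegral_jacksonPoly_le k hxl
    refine (Finset.prod_le_prod (fun l _ => setIntegral_nonneg measurableSet_Icc
      fun s _ => hf0 l s) fun l _ => hfb l).trans (le_of_eq ?_)
    rw [Finset.prod_mul_distrib, Finset.prod_ite_eq' Finset.univ i fun _ => 1 / (2 * k + 1 : ℝ) ^ 2]
    simp
  have hsplit : ∫ y in solidSimplex n, K y * (1 - (r ^ 2)⁻¹ * ∑ i, (y i - x i) ^ 2) =
      (∫ y in solidSimplex n, K y) -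
        (r ^ 2)⁻¹ * ∑ i, ∫ y in solidSimplex n, K y * (y i - x i) ^ 2 := by
    rw [← integral_finsetSum _ fun i _ => hint _ (by fun_prop), ← integral_const_mul,
      ← integral_sub (hint K hKc) (hint _ (by fun_prop))]
    refine integral_congr_ae (Eventually.of_forall fun y => ?_)
    simp only [← Finset.mul_sum]
    ring
  rw [hsplit]
  have hsum : ∑ i, ∫ y in solidSimplex n, K y * (y i - x i) ^ 2 ≤
      n * (16 ^ n / (2 * k + 1) ^ n * (1 / (2 * k + 1) ^ 2)) := by
    refine (Finset.sum_le_sum fun i _ => hmom i).trans (le_of_eq ?_)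
    simp
  have h2 : (r ^ 2)⁻¹ * ∑ i, ∫ y in solidSimplex n, K y * (y i - x i) ^ 2 ≤
      (r ^ 2)⁻¹ * (n * (16 ^ n / (2 * k + 1) ^ n * (1 / (2 * k + 1) ^ 2))) := by gcongr
  have e : (volume.real (solidSimplex n) / 32 ^ n - n * 16 ^ n / ((2 * k + 1) * r) ^ 2) /
        (2 * k + 1) ^ n = volume.real (solidSimplex n) / 32 ^ n / (2 * k + 1) ^ n -
      (r ^ 2)⁻¹ * (n * (16 ^ n / (2 * k + 1) ^ n * (1 / (2 * k + 1) ^ 2))) := by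
    field_simp
  rw [e]
  linarith

open Classical in
/-- Lower bound for the total weight of a positive cubature formula in a ball. -/
theorem WeightedPoints.le_sum_weight_ball (hF : F.IsCubature (simplexMeasure n) t)
    (hpos : F.IsPositive) (hsub : ∀ p ∈ F.points, p ∈ solidSimplex n)
    {x : EuclideanSpace ℝ (Fin n)} (hx : x ∈ solidSimplex n) {r : ℝ} (hr : 0 < r) {k : ℕ}
    (hk : n * (8 * k) + 2 ≤ t) :
    (volume.real (solidSimplex n))⁻¹ * ((volume.real (solidSimplex n) / 32 ^ n -
        n * 16 ^ n / ((2 * k + 1) * r) ^ 2) / (2 * k + 1) ^ n) ≤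
      ∑ p ∈ F.points.filter (fun p => p ∈ Metric.ball x r), F.weight p := by
  -- On the simplex the kernel factor lies in `[0, 1]`, and the quadratic factor is at most `1` and
  -- nonpositive off the ball. Hence `P` is below the indicator of the ball at every cubature point.
  set P : MvPolynomial (Fin n) ℝ :=
    (∏ i, Polynomial.aeval (barycentricPoly n i.succ)
      ((jacksonPoly k).comp (Polynomial.X - Polynomial.C (x i)))) *
    (1 - MvPolynomial.C (r ^ 2)⁻¹ * ∑ i, (MvPolynomial.X i - MvPolynomial.C (x i)) ^ 2) with hP
  have hPe : ∀ y : EuclideanSpace ℝ (Fin n), MvPolynomial.eval (fun i => y i) P =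
      (∏ i, (jacksonPoly k).eval (y i - x i)) *
        (1 - (r ^ 2)⁻¹ * ∑ i, (y i - x i) ^ 2) := fun y => by
    simp only [hP, map_mul, map_prod, eval_aeval, eval_barycentricPoly, barycentric_succ, map_sub,
      map_sum, map_pow, MvPolynomial.eval_X, MvPolynomial.eval_C, map_one, Polynomial.eval_comp,
      Polynomial.eval_sub, Polynomial.eval_X, Polynomial.eval_C]
  have hPd : P.totalDegree ≤ t := by
    refine (MvPolynomial.totalDegree_mul _ _).trans (le_trans (add_le_add ?_ ?_) hk)
    · refine (MvPolynomial.totalDegree_finsetProd _ _).trans ?_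
      refine (Finset.sum_le_sum fun i _ =>
        (totalDegree_aeval_le (totalDegree_barycentricPoly_le _) _).trans
          (Polynomial.natDegree_comp_le.trans
            (Nat.mul_le_mul (natDegree_jacksonPoly_le k)
              (Polynomial.natDegree_X_sub_C (x i)).le))).trans ?_
      simp
    · refine (MvPolynomial.totalDegree_sub _ _).trans (max_le (by simp) ?_)
      refine (MvPolynomial.totalDegree_mul _ _).trans ?_
      rw [MvPolynomial.totalDegree_C, zero_add]
      refine MvPolynomial.totalDegree_finsetSum_le fun i _ => ?_
      refine (MvPolynomial.totalDegree_pow _ _).trans ?_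
      have := (MvPolynomial.totalDegree_sub_C_le (MvPolynomial.X i) (x i)).trans
        (MvPolynomial.totalDegree_X (R := ℝ) i).le
      omega
  have hdist : ∀ y : EuclideanSpace ℝ (Fin n), ∑ i, (y i - x i) ^ 2 = dist y x ^ 2 := fun y => by
    rw [EuclideanSpace.dist_eq, Real.sq_sqrt (Finset.sum_nonneg fun i _ => sq_nonneg _)]
    simp only [Real.dist_eq, sq_abs]
  have hV := volume_real_solidSimplex_pos n
  calc _ ≤ (volume.real (solidSimplex n))⁻¹ *
        ∫ y in solidSimplex n, MvPolynomial.eval (fun i => y i) P := by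
        simp only [hPe]
        gcongr
        exact le_setIntegral_jackson_prod hx hr k
    _ = ∑ y ∈ F.points, F.weight y * MvPolynomial.eval (fun i => y i) P := by
        rw [← integral_simplexMeasure]; exact hF P hPd
    _ ≤ ∑ y ∈ F.points, if y ∈ Metric.ball x r then F.weight y else 0 := by
        refine Finset.sum_le_sum fun y hy => ?_
        have hw := (hpos y hy).le
        have hK0 : 0 ≤ ∏ i, (jacksonPoly k).eval (y i - x i) :=
          Finset.prod_nonneg fun i _ => jacksonPoly_nonneg _ _
        have hK1 : ∏ i, (jacksonPoly k).eval (y i - x i) ≤ 1 :=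
          Finset.prod_le_one (fun i _ => jacksonPoly_nonneg _ _) fun i _ =>
            jacksonPoly_le_one k (abs_sub_le_one_of_mem_solidSimplex (hsub y hy) hx i)
        rw [hPe, hdist]
        have hd : (0 : ℝ) ≤ (r ^ 2)⁻¹ * dist y x ^ 2 := by positivity
        split_ifs with h
        · refine mul_le_of_le_one_right hw ?_
          refine (mul_le_of_le_one_right hK0 (by linarith)).trans hK1
        · refine mul_nonpos_of_nonneg_of_nonpos hw (mul_nonpos_of_nonneg_of_nonpos hK0 ?_)
          rw [Metric.mem_ball, not_lt] at h
          rw [sub_nonpos, ← div_eq_inv_mul, one_le_div (by positivity)]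
          gcongr
    _ = _ := (Finset.sum_filter _ _).symm

end Cubature

/-! ### Counting points and passing to the limit -/

open Classical in
/-- A positive cubature formula of degree `t` on the simplex has at least about
`r ^ n * t ^ n * ∏ x_k ^ (-1/2)` points in the ball of radius `r` about `x`. -/
theorem exists_le_card_ball (n : ℕ) :
    ∃ c : ℝ, 0 < c ∧ ∃ R : ℝ, 0 < R ∧ ∀ (F : WeightedPoints n) (t : ℕ),
      F.IsCubature (simplexMeasure n) t → F.IsPositive → (∀ p ∈ F.points, p ∈ solidSimplex n) →
      ∀ x ∈ solidSimplex n, ∀ r : ℝ, 0 < r → r ≤ 1 → R ≤ t * r →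
        c * (r ^ n * t ^ n) ≤ (F.points.filter (fun p => p ∈ Metric.ball x r)).card *
          ∏ j, (Real.sqrt (barycentric x j + (n + 1) * r) + 8 * (n + 1) / t) := by
  set V := volume.real (solidSimplex n) with hVdef
  have hV : 0 < V := volume_real_solidSimplex_pos n
  -- A lower bound for `(2k+1) r` that makes the second-moment loss at most half of the main term;
  -- `512 = 16 * 32`. The `+ 1` gives `A ≤ A ^ 2`.
  set A : ℝ := 2 * n * 512 ^ n / V + 1 with hA
  have hA1 : 1 ≤ A := le_add_of_nonneg_left (by positivity)
  set W : ℝ := V⁻¹ * (n + 1) * 256 ^ n * (8 * (n + 1)) ^ n with hW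
  have hW0 : 0 < W := by positivity
  set κ : ℝ := 1 / (2 * 32 ^ n * (2 * A + 3) ^ n) with hκ
  have hκ0 : 0 < κ := by positivity
  -- The threshold on `t r` ensures that `8nk + 2 ≤ t` for `k ≤ A / r + 1` and `r ≤ 1`.
  refine ⟨κ / W, by positivity, 8 * n * A + 8 * n + 2, by positivity, ?_⟩
  intro F t hF hpos hsub x hx r hr hr1 hR
  have ht : (0 : ℝ) < t := by
    have : (0 : ℝ) < t * r := lt_of_lt_of_le (by positivity) hR
    exact pos_of_mul_pos_left this hr.le
  have hmass : κ * r ^ n ≤ ∑ p ∈ F.points.filter (fun p => p ∈ Metric.ball x r), F.weight p := by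
    -- The mass estimate works at scale `r`, not at the finest scale `1/t`: `(2k+1) r` stays between
    -- `A` and `2A + 3`.
    set k := ⌈A / r⌉₊ with hk
    have hk1 : A / r ≤ k := Nat.le_ceil _
    have hk2 : (k : ℝ) ≤ A / r + 1 := (Nat.ceil_lt_add_one (by positivity)).le
    rw [div_le_iff₀ hr] at hk1
    have hk3 : k * r ≤ A + r := by
      calc k * r ≤ (A / r + 1) * r := by gcongr
        _ = A + r := by field_simp
    have hdeg : n * (8 * k) + 2 ≤ t := by
      have : ((n * (8 * k) + 2 : ℕ) : ℝ) * r ≤ t * r := by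
        push_cast
        calc ((n : ℝ) * (8 * k) + 2) * r = 8 * n * (k * r) + 2 * r := by ring
          _ ≤ 8 * n * (A + 1) + 2 * 1 := by gcongr; linarith
          _ = 8 * n * A + 8 * n + 2 := by ring
          _ ≤ _ := hR
      exact_mod_cast le_of_mul_le_mul_right this hr
    refine le_trans ?_ (F.le_sum_weight_ball hF hpos hsub hx hr hdeg)
    rw [← hVdef]
    have hmr : A ≤ (2 * k + 1) * r := by nlinarith [Nat.cast_nonneg (α := ℝ) k]
    have hmr2 : (2 * k + 1) * r ≤ 2 * A + 3 := by nlinarith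
    have h1 : n * 16 ^ n / ((2 * k + 1) * r) ^ 2 ≤ V / (2 * 32 ^ n) := by
      have h2 : A ≤ ((2 * k + 1) * r) ^ 2 := by nlinarith
      calc n * 16 ^ n / ((2 * k + 1) * r) ^ 2 ≤ n * 16 ^ n / A := by gcongr
        _ ≤ V / (2 * 32 ^ n) := by
          rw [div_le_div_iff₀ (by positivity) (by positivity)]
          have h3 : V * A = 2 * n * 512 ^ n + V := by rw [hA]; field_simp
          have h4 : (512 : ℝ) ^ n = 16 ^ n * 32 ^ n := by rw [← mul_pow]; norm_num
          rw [h3, h4]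
          linarith
    have h5 : V / 32 ^ n = V / (2 * 32 ^ n) + V / (2 * 32 ^ n) := by field_simp; norm_num
    calc κ * r ^ n = (1 / (2 * 32 ^ n)) * (r / (2 * A + 3)) ^ n := by
          rw [hκ, div_pow]; field_simp
      _ ≤ (1 / (2 * 32 ^ n)) * (1 / (2 * k + 1)) ^ n := by
          gcongr ?_ * ?_ ^ n
          rw [div_le_div_iff₀ (by positivity) (by positivity)]
          linarith
      _ = V⁻¹ * (V / (2 * 32 ^ n) / (2 * k + 1) ^ n) := by rw [one_div_pow]; field_simp
      _ ≤ _ := by gcongr; linarith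
  have hweight : ∀ p ∈ F.points.filter (fun p => p ∈ Metric.ball x r), F.weight p ≤
      W / t ^ n * ∏ j, (Real.sqrt (barycentric x j + (n + 1) * r) + 8 * (n + 1) / t) := by
    intro p hp
    obtain ⟨hpF, hpB⟩ := Finset.mem_filter.1 hp
    -- Here `k` is of order `t`. Using `n + 1` covers `n = 0`, and the `+ 1` in `2k + 1` compensates
    -- for the rounding, even when `k = 0`.
    set k := t / (8 * (n + 1)) with hk
    have hdeg : n * (4 * k) ≤ t := by
      have := Nat.div_mul_le_self t (8 * (n + 1))
      rw [← hk] at this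
      nlinarith
    have hm : (t : ℝ) / (8 * (n + 1)) ≤ 2 * k + 1 := by
      have := Nat.lt_mul_div_succ t (show 0 < 8 * (n + 1) by omega)
      rw [← hk] at this
      have h2 : (t : ℝ) < 8 * (n + 1) * (k + 1) := by exact_mod_cast this
      rw [div_le_iff₀ (by positivity)]
      nlinarith [Nat.cast_nonneg (α := ℝ) k, Nat.cast_nonneg (α := ℝ) n,
        mul_nonneg (Nat.cast_nonneg (α := ℝ) k) (Nat.cast_nonneg (α := ℝ) n)]
    have hm' : 1 / (2 * k + 1 : ℝ) ≤ 8 * (n + 1) / t := by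
      rw [div_le_div_iff₀ (by positivity) ht]
      rw [div_le_iff₀ (by positivity)] at hm
      linarith
    refine (F.weight_le hF hpos hsub hpF hdeg).trans ?_
    have hprod : ∏ j, (Real.sqrt (barycentric p j) + 1 / (2 * k + 1)) ≤
        ∏ j, (Real.sqrt (barycentric x j + (n + 1) * r) + 8 * (n + 1) / t) := by
      refine Finset.prod_le_prod (fun j _ => by positivity) fun j _ => ?_
      refine add_le_add (Real.sqrt_le_sqrt ?_) hm'
      have h1 := (le_abs_self _).trans (abs_barycentric_sub_le p x j)
      have h2 : (n + 1) * dist p x ≤ (n + 1) * r := by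
        gcongr
        exact (Metric.mem_ball.1 hpB).le
      linarith
    calc _ = V⁻¹ * (n + 1) * 256 ^ n * (1 / (2 * k + 1)) ^ n *
          ∏ j, (Real.sqrt (barycentric p j) + 1 / (2 * k + 1)) := by
          rw [one_div_pow]; ring
      _ ≤ V⁻¹ * (n + 1) * 256 ^ n * (8 * (n + 1) / t) ^ n *
          ∏ j, (Real.sqrt (barycentric x j + (n + 1) * r) + 8 * (n + 1) / t) := by
          gcongr
      _ = _ := by rw [hW, div_pow]; ring
  have h := hmass.trans (Finset.sum_le_card_nsmul _ _ _ hweight)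
  rw [nsmul_eq_mul] at h
  calc κ / W * (r ^ n * t ^ n) = κ * r ^ n * (t ^ n / W) := by ring
    _ ≤ _ := mul_le_mul_of_nonneg_right h (by positivity)
    _ = _ := by
      generalize ∏ j, (Real.sqrt (barycentric x j + (n + 1) * r) + 8 * (n + 1) / (t : ℝ)) = q
      field_simp

/-- If some `b i` with `i ∈ s` vanishes, both sides are `∞`: all factors on the left are nonzero. -/
theorem prod_ofReal_rpow_neg_half {ι : Type*} (s : Finset ι) (b : ι → ℝ) (hb : ∀ i, 0 ≤ b i) :
    ∏ i ∈ s, ENNReal.ofReal (b i) ^ (-(1 / 2) : ℝ) =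
      (ENNReal.ofReal (∏ i ∈ s, Real.sqrt (b i)))⁻¹ := by
  rw [ENNReal.ofReal_prod_of_nonneg fun i _ => Real.sqrt_nonneg _,
    ENNReal.prod_inv_distrib fun i _ j _ _ => Or.inr ENNReal.ofReal_ne_top]
  refine Finset.prod_congr rfl fun i _ => ?_
  rw [ENNReal.rpow_neg, ENNReal.ofReal_rpow_of_nonneg (hb i) (by norm_num), Real.sqrt_eq_rpow]

theorem mainTheorem8 (n : ℕ) :
    ∃ c : ℝ≥0, 0 < c ∧
      ∀ (t : ℕ → ℕ) (F : ℕ → WeightedPoints n),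
        Tendsto t atTop atTop →
        (∀ j, (F j).IsCubature (simplexMeasure n) (t j)) →
        (∀ j, (F j).IsPositive) →
        (∀ j, (F j).IsInterior (simplexMeasure n) ∨ (F j).IsBoundary (simplexMeasure n)) →
        ∀ x ∈ solidSimplex n, ∀ r : ℕ → ℝ,
          (∀ j, 0 < r j) →
          Tendsto r atTop (𝓝 0) →
          Tendsto (fun j => (t j : ℝ) * r j) atTop atTop →
          (c : ℝ≥0∞) * ∏ k, ENNReal.ofReal (barycentric x k) ^ (-(1 / 2) : ℝ) ≤
            liminf (fun j =>
              (F j).pointDensity (simplexMeasure n) x (r j) / (t j : ℝ≥0∞) ^ n) atTop := by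
  classical
  obtain ⟨c, hc, R, hR, H⟩ := exists_le_card_ball n
  set β : ℝ := (volume.real (solidSimplex n))⁻¹ *
    volume.real (Metric.ball (0 : EuclideanSpace ℝ (Fin n)) 1) with hβ
  have hβ0 : 0 < β := mul_pos (inv_pos.2 (volume_real_solidSimplex_pos n))
    (ENNReal.toReal_pos (Metric.measure_ball_pos volume _ one_pos).ne' measure_ball_lt_top.ne)
  refine ⟨(c / β).toNNReal, Real.toNNReal_pos.2 (by positivity), ?_⟩
  intro t F ht hF hpos hib x hx r hr hr0 htr
  rw [prod_ofReal_rpow_neg_half _ _ hx]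
  set Q : ℕ → ℝ := fun j =>
    ∏ k, (Real.sqrt (barycentric x k + (n + 1) * r j) + 8 * (n + 1) / t j) with hQ
  have hQlim : Tendsto Q atTop (𝓝 (∏ k, Real.sqrt (barycentric x k))) := by
    refine tendsto_finsetProd _ fun k _ => ?_
    have h1 : Tendsto (fun j => (8 * (n + 1) : ℝ) / t j) atTop (𝓝 0) :=
      (tendsto_natCast_atTop_atTop.comp ht).const_div_atTop _
    have h2 : Tendsto (fun j => Real.sqrt (barycentric x k + (n + 1) * r j)) atTop
        (𝓝 (Real.sqrt (barycentric x k + (n + 1) * 0))) :=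
      ((hr0.const_mul _).const_add _).sqrt
    simpa using h2.add h1
  -- Inversion is continuous on `[0, ∞]`, so interior and boundary points `x` are handled together.
  have hlim : Tendsto (fun j => ((c / β).toNNReal : ℝ≥0∞) * (ENNReal.ofReal (Q j))⁻¹) atTop
      (𝓝 (((c / β).toNNReal : ℝ≥0∞) *
        (ENNReal.ofReal (∏ k, Real.sqrt (barycentric x k)))⁻¹)) := by
    refine ENNReal.Tendsto.const_mul ?_ (Or.inr ENNReal.coe_ne_top)
    exact (ENNReal.tendsto_ofReal hQlim).inv
  rw [← hlim.liminf_eq]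
  refine liminf_le_liminf ?_
  filter_upwards [htr.eventually_ge_atTop R, hr0.eventually_le_const one_pos] with j hj hj1
  have hrj := hr j
  have htj : (0 : ℝ) < t j := pos_of_mul_pos_left (hR.trans_le hj) hrj.le
  have hcard := H (F j) (t j) (hF j) (hpos j) (WeightedPoints.mem_solidSimplex (hib j)) x hx (r j)
    hrj hj1 hj
  have hQj : 0 < Q j := Finset.prod_pos fun k _ => by positivity
  change c * (r j ^ n * (t j : ℝ) ^ n) ≤ _ * Q j at hcard
  unfold WeightedPoints.pointDensity
  rw [Finset.filter_congr_decidable] at hcard ⊢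
  set N := ((F j).points.filter (fun p => p ∈ Metric.ball x (r j))).card with hN
  -- A nonzero count justifies clearing the denominator `μ(B(x, r))` without showing that this
  -- measure is positive.
  have hN0 : N ≠ 0 := fun h => by
    rw [h, Nat.cast_zero, zero_mul] at hcard
    exact absurd hcard (not_le.2 (by positivity))
  have htj' : (t j : ℝ≥0∞) ≠ 0 := by
    exact_mod_cast (Nat.cast_pos.1 htj).ne'
  rw [ENNReal.le_div_iff_mul_le (Or.inl (pow_ne_zero _ htj'))
      (Or.inl (ENNReal.pow_ne_top (ENNReal.natCast_ne_top _))),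
    ENNReal.le_div_iff_mul_le (Or.inr (by exact_mod_cast hN0))
      (Or.inr (ENNReal.natCast_ne_top _))]
  refine (mul_le_mul_right (simplexMeasure_ball_le x hrj) _).trans ?_
  rw [← hβ, ← ENNReal.ofReal_inv_of_pos hQj, ← ENNReal.ofReal_natCast (t j),
    ← ENNReal.ofReal_pow htj.le, ← ENNReal.ofReal_natCast N]
  change ENNReal.ofReal (c / β) * _ * _ * _ ≤ _
  rw [← ENNReal.ofReal_mul (by positivity), ← ENNReal.ofReal_mul (by positivity),
    ← ENNReal.ofReal_mul (by positivity)]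
  refine ENNReal.ofReal_le_ofReal ?_
  calc c / β * (Q j)⁻¹ * (t j : ℝ) ^ n * (r j ^ n * β) = c * (r j ^ n * (t j : ℝ) ^ n) / Q j := by
        field_simp
    _ ≤ N := by rwa [div_le_iff₀ hQj]
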